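/- Let $[v_0:\dots:v_5]$ be homogeneous coordinates on $\mathbb P^5=\mathbb P^5_{\mathbb C}$, and put $F_1=v_2v_3^2-v_0^2v_5$, $F_2=v_1v_3^2-v_0v_5^2$, $F_3=v_2^2v_3-v_0^2v_4$, $F_5=v_1^2v_3-v_4v_5^2$, $F_6=v_1v_2^2-v_0v_4^2$, $F_7=v_1^2v_2-v_4^2v_5$. Let $Y'\subset\mathbb P^5$ be the complete intersection threefold $A_1=A_2=0$, where $$A_1=F_1+F_2-F_6-F_7,\qquad A_2=F_2-F_3+F_5-F_6,$$ and let $Y'_{\mathrm{reg}}$ be its smooth locus. Let $\omega_{Y'}$ be the canonical holomorphic $3$-form (Poincaré residue) on $Y'_{\mathrm{reg}}$, given in the chart $v_0=1$ by $\dfrac{dv_3\wedge dv_4\wedge dv_5}{\det(\partial A_i/\partial v_j)_{i,j=1,2}}$. Let $\sigma$ be the automorphism of $\mathbb P^5$ $$v_0\mapsto v_3,\quad v_1\mapsto v_4,\quad v_2\mapsto v_0,\quad v_3\mapsto v_5,\quad v_4\mapsto v_2,\quad v_5\mapsto v_1 .$$ Then: 1. $\sigma$ restricts to an automorphism of $Y'$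 of order exactly $6$, preserving $Y'_{\mathrm{reg}}$, and $\sigma^*\omega_{Y'}=-\omega_{Y'}$ on $Y'_{\mathrm{reg}}$; more generally $(\sigma^k)^*\omega_{Y'}=(-1)^k\omega_{Y'}$ for all $k\ge 0$. 2. Let $\pi:Y_6\to Y'$ be any crepant resolution of $Y'$, that is, $Y_6$ is a compact connected complex threefold, $\pi$ is holomorphic and surjective, biholomorphic over $Y'_{\mathrm{reg}}$ with $\pi^{-1}(Y'_{\mathrm{reg}})$ dense, and $\pi^*\omega_{Y'}$ extends to a nowhere vanishing holomorphic $3$-form on $Y_6$. Then the induced $\mathbb Z/6\mathbb Z$-action on $H^{3,0}(Y_6)=H^0(Y_6,\Omega^3_{Y_6})$ is by $\sigma\mapsto -1$: if $\tau:Y_6\to Y_6$ is a holomorphic lift of $\sigma^k$, i.e. $\pi\circ\tau=\sigma^k\circ\pi$ with $k\ge0$, then $\tau^*\omega=(-1)^k\omega$ for every $\omega\in H^{3,0}(Y_6)$; in particular a lift of $\sigma$ maps $\omega$, and so the extension of $\pi^*\omega_{Y'}$, to its negative. -/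

import Mathlib

open scoped Manifold Topology LinearAlgebra.Projectivization

noncomputable section

namespace DelPezzoCY

/-- The vector space `ℂ⁶`, with coordinates `v₀, …, v₅`. -/
abbrev V : Type := Fin 6 → ℂ

/-- Complex projective space of dimension five. -/
abbrev P5 : Type := ℙ ℂ V

section Equations

open MvPolynomial

/-! The cubics in the ideal of the projected del Pezzo surface that enter the equations. -/

def F1 : MvPolynomial (Fin 6) ℂ := X 2 * X 3 ^ 2 - X 0 ^ 2 * X 5
def F2 : MvPolynomial (Fin 6) ℂ := X 1 * X 3 ^ 2 - X 0 * X 5 ^ 2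
def F3 : MvPolynomial (Fin 6) ℂ := X 2 ^ 2 * X 3 - X 0 ^ 2 * X 4
def F5 : MvPolynomial (Fin 6) ℂ := X 1 ^ 2 * X 3 - X 4 * X 5 ^ 2
def F6 : MvPolynomial (Fin 6) ℂ := X 1 * X 2 ^ 2 - X 0 * X 4 ^ 2
def F7 : MvPolynomial (Fin 6) ℂ := X 1 ^ 2 * X 2 - X 4 ^ 2 * X 5

/-- The two cubic forms defining the threefold. -/
def A1 : MvPolynomial (Fin 6) ℂ := F1 + F2 - F6 - F7
def A2 : MvPolynomial (Fin 6) ℂ := F2 - F3 + F5 - F6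

/-- The differential of a polynomial `A` at `v`, as a linear form on `ℂ⁶`. -/
def diff (A : MvPolynomial (Fin 6) ℂ) (v : V) : V →ₗ[ℂ] ℂ :=
  ∑ i, eval v (pderiv i A) • LinearMap.proj i

/-- The affine cone over the threefold: the common zeros of the two cubics in `ℂ⁶`. -/
def cone : Set V := {v | eval v A1 = 0 ∧ eval v A2 = 0}

/-- The points of the cone where the differentials of the two cubics are linearly independent. -/
def smoothCone : Set V :=
  {v | v ∈ cone ∧ LinearIndependent ℂ ![diff A1 v, diff A2 v]}

end Equations

/-- The complete intersection threefold `Y' ⊂ ℙ⁵`. -/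
def Y' : Set P5 := {p | p.rep ∈ cone}

/-- The smooth locus of `Y'` (Jacobian criterion). -/
def Y'reg : Set P5 := {p | p.rep ∈ smoothCone}

/-- The tangent space to the cone at a point `v` of `smoothCone`.  The tangent space of `Y'` at
`[v]` is the quotient of this space by the line spanned by `v`. -/
def coneTangent (v : V) : Submodule ℂ V := LinearMap.ker (diff A1 v) ⊓ LinearMap.ker (diff A2 v)

/-- The minor `(dA₁ ∧ dA₂)(a, b)` at the point `v`. -/
def jac (v a b : V) : ℂ := diff A1 v a * diff A2 v b - diff A1 v b * diff A2 v a

/-- The determinant `det (v, x₀, x₁, x₂, a, b)`. -/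
def rowDet (v : V) (x : Fin 3 → V) (a b : V) : ℂ :=
  (Matrix.of ![v, x 0, x 1, x 2, a, b]).det

open scoped Classical in
/-- The canonical form `ω_{Y'}`, the Poincaré residue of the standard rational five-form with
simple poles along the two cubics, in homogeneous coordinates: its value at `[v]` on the classes of
`x₀, x₁, x₂ ∈ coneTangent v` is `det (v, x₀, x₁, x₂, a, b) / (dA₁ ∧ dA₂)(a, b)`, for any `a, b`
with non-zero denominator.  See `residueForm_eq` (independence of `a, b`), `residueForm_smul_add`
(it descends to `Y'`) and `residueForm_chart` (the formula in an affine chart). -/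
def residueForm (v : V) (x : Fin 3 → V) : ℂ :=
  if h : ∃ ab : V × V, jac v ab.1 ab.2 ≠ 0 then
    rowDet v x h.choose.1 h.choose.2 / jac v h.choose.1 h.choose.2
  else 0

/-! Well-definedness of the residue form. -/

section WellDefined

open MvPolynomial

lemma diff_self {v : V} (hv : v ∈ cone) : v ∈ coneTangent v := by
  obtain ⟨h1, h2⟩ := hv
  simp only [coneTangent, Submodule.mem_inf, LinearMap.mem_ker, diff, Fin.sum_univ_six,
    LinearMap.add_apply, LinearMap.smul_apply, LinearMap.proj_apply, smul_eq_mul]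
  constructor
  · have h : (3 : ℂ) * eval v A1 = 0 := by rw [h1, mul_zero]
    rw [← h]
    simp [A1, F1, F2, F6, F7, pderiv_X, Derivation.leibniz, Derivation.leibniz_pow]
    ring
  · have h : (3 : ℂ) * eval v A2 = 0 := by rw [h2, mul_zero]
    rw [← h]
    simp [A2, F2, F3, F5, F6, pderiv_X, Derivation.leibniz, Derivation.leibniz_pow]
    ring

lemma rowDet_lin_left (v : V) (x : Fin 3 → V) (α β : ℂ) (a b t c : V) :
    rowDet v x (α • a + β • b + t) c = α * rowDet v x a c + β * rowDet v x b c + rowDet v x t c := by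
  have h (e : V) : Matrix.of ![v, x 0, x 1, x 2, e, c] =
      Matrix.updateRow (Matrix.of ![v, x 0, x 1, x 2, 0, c]) 4 e := by
    funext i; fin_cases i <;> rfl
  unfold rowDet
  rw [h, h a, h b, h t, Matrix.det_updateRow_add, Matrix.det_updateRow_add,
    Matrix.det_updateRow_smul, Matrix.det_updateRow_smul]

lemma rowDet_swap (v : V) (x : Fin 3 → V) (a b : V) : rowDet v x a b = - rowDet v x b a := by
  have h : Matrix.of ![v, x 0, x 1, x 2, a, b] =
      Matrix.submatrix (Matrix.of ![v, x 0, x 1, x 2, b, a]) (Equiv.swap (4 : Fin 6) 5) id := by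
    funext i; fin_cases i <;> rfl
  unfold rowDet
  rw [h, Matrix.det_permute]
  simp

lemma rowDet_eq_zero {v : V} (hv : v ∈ cone) {x : Fin 3 → V} (hx : ∀ i, x i ∈ coneTangent v)
    {a b : V} (hab : jac v a b ≠ 0) {t : V} (ht : t ∈ coneTangent v) (s : V) :
    rowDet v x t s = 0 := by
  by_contra hD
  have hvv := diff_self hv
  have hker : ∀ w ∈ coneTangent v, diff A1 v w = 0 ∧ diff A2 v w = 0 := fun w hw => hw
  have key : diff A2 v s • diff A1 v - diff A1 v s • diff A2 v = 0 := by
    have hli : LinearIndependent ℂ ![v, x 0, x 1, x 2, t, s] :=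
      Matrix.linearIndependent_rows_of_det_ne_zero hD
    have hsp := hli.span_eq_top_of_card_eq_finrank' (by simp)
    apply LinearMap.ext_on_range hsp
    intro i
    fin_cases i
    · simp [hker v hvv]
    · simp [hker _ (hx 0)]
    · simp [hker _ (hx 1)]
    · simp [hker _ (hx 2)]
    · simp [hker _ ht]
    · simp [mul_comm]
  have k : ∀ c, diff A2 v s * diff A1 v c = diff A1 v s * diff A2 v c := fun c => by
    have := LinearMap.congr_fun key c
    simpa [sub_eq_zero] using this
  apply hab
  by_cases h1 : diff A1 v s = 0
  · by_cases h2 : diff A2 v s = 0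
    · have hs : s ∈ coneTangent v := ⟨h1, h2⟩
      have hli : LinearIndependent ℂ ![v, x 0, x 1, x 2, t, s] :=
      Matrix.linearIndependent_rows_of_det_ne_zero hD
      have hsp := hli.span_eq_top_of_card_eq_finrank' (by simp)
      have : diff A1 v = 0 := by
        apply LinearMap.ext_on_range hsp
        intro i
        fin_cases i
        · simp [hker v hvv]
        · simp [hker _ (hx 0)]
        · simp [hker _ (hx 1)]
        · simp [hker _ (hx 2)]
        · simp [hker _ ht]
        · simp [h1]
      simp [jac, this]
    · have : ∀ c, diff A1 v c = 0 := fun c => by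
        have := k c
        rw [h1, zero_mul] at this
        exact (mul_eq_zero.1 this).resolve_left h2
      simp [jac, this]
  · apply (mul_eq_zero.1 (?_ : diff A1 v s * jac v a b = 0)).resolve_left h1
    unfold jac
    linear_combination diff A1 v b * k a - diff A1 v a * k b

/-- The residue form does not depend on the choice of `a, b`. -/
lemma residueForm_eq {v : V} (hv : v ∈ cone) {x : Fin 3 → V} (hx : ∀ i, x i ∈ coneTangent v)
    {a b : V} (hab : jac v a b ≠ 0) :
    residueForm v x = rowDet v x a b / jac v a b := by
  have h : ∃ ab : V × V, jac v ab.1 ab.2 ≠ 0 := ⟨(a, b), hab⟩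
  rw [residueForm, dif_pos h]
  have hc := h.choose_spec
  set a' := h.choose.1
  set b' := h.choose.2
  rw [div_eq_div_iff hc hab]
  have dec (c : V) : ∃ t ∈ coneTangent v,
      c = (jac v c b / jac v a b) • a + (jac v a c / jac v a b) • b + t := by
    refine ⟨c - (jac v c b / jac v a b) • a - (jac v a c / jac v a b) • b, ?_, by abel⟩
    constructor <;> simp only [LinearMap.mem_ker, SetLike.mem_coe, map_sub, map_smul, smul_eq_mul] <;>
      field_simp <;> simp only [jac] <;> ring
  obtain ⟨t, ht, e⟩ := dec a'
  obtain ⟨u, hu, e'⟩ := dec b'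
  have z := fun s => rowDet_eq_zero hv hx hab ht s
  have z' := fun s => rowDet_eq_zero hv hx hab hu s
  have r0 (s : V) : rowDet v x s s = 0 := by
    have := rowDet_swap v x s s
    linear_combination this / 2
  have s1 : rowDet v x a' b' = (jac v a' b / jac v a b) * rowDet v x a b' +
      (jac v a a' / jac v a b) * rowDet v x b b' := by
    conv_lhs => rw [e]
    rw [rowDet_lin_left, z, add_zero]
  have s2 : rowDet v x a b' = (jac v a b' / jac v a b) * rowDet v x a b := by
    rw [rowDet_swap]
    conv_lhs => rw [e']
    rw [rowDet_lin_left, z', r0, rowDet_swap v x b a]; ring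
  have s3 : rowDet v x b b' = - (jac v b' b / jac v a b) * rowDet v x a b := by
    rw [rowDet_swap]
    conv_lhs => rw [e']
    rw [rowDet_lin_left, z', r0]; ring
  rw [s1, s2, s3]
  field_simp
  simp only [jac]
  ring

lemma diff_smul (c : ℂ) (v w : V) :
    diff A1 (c • v) w = c ^ 2 * diff A1 v w ∧ diff A2 (c • v) w = c ^ 2 * diff A2 v w := by
  simp only [diff, Fin.sum_univ_six, LinearMap.add_apply, LinearMap.smul_apply,
    LinearMap.proj_apply, smul_eq_mul]
  constructor
  · simp [A1, F1, F2, F6, F7, pderiv_X, Derivation.leibniz, Derivation.leibniz_pow]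
    ring
  · simp [A2, F2, F3, F5, F6, pderiv_X, Derivation.leibniz, Derivation.leibniz_pow]
    ring

lemma smul_mem_cone {v : V} (hv : v ∈ cone) (c : ℂ) : c • v ∈ cone := by
  have e1 : eval (c • v) A1 = c ^ 3 * eval v A1 := by simp [A1, F1, F2, F6, F7]; ring
  have e2 : eval (c • v) A2 = c ^ 3 * eval v A2 := by simp [A2, F2, F3, F5, F6]; ring
  exact ⟨by rw [e1, hv.1, mul_zero], by rw [e2, hv.2, mul_zero]⟩

lemma exists_jac_ne_zero {v : V} (hv : v ∈ smoothCone) : ∃ a b, jac v a b ≠ 0 := by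
  by_contra! h
  have hli := hv.2
  rw [LinearIndependent.pair_iff] at hli
  have h0 : ∀ a, diff A1 v a = 0 := fun a => by
    have := (hli (diff A2 v a) (-diff A1 v a) (by
      refine LinearMap.ext fun b => ?_
      have := h a b
      simp only [jac] at this
      simp
      linear_combination -this)).2
    simpa using this
  have := (hli 1 0 (LinearMap.ext fun b => by simp [h0])).1
  simp at this

/-- The residue form is invariant under a change of representatives `v` of a point of `Y'` and
`xᵢ` of tangent vectors of `Y'`. -/
lemma residueForm_smul_add {v : V} (hv : v ∈ smoothCone) {x : Fin 3 → V}
    (hx : ∀ i, x i ∈ coneTangent v) {c : ℂ} (hc : c ≠ 0) (m : Fin 3 → ℂ) :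
    residueForm (c • v) (fun i => c • x i + m i • v) = residueForm v x := by
  obtain ⟨a, b, hab⟩ := exists_jac_ne_zero hv
  have hJ : jac (c • v) a b = c ^ 4 * jac v a b := by
    simp only [jac, (diff_smul c v _).1, (diff_smul c v _).2]; ring
  have hvv := diff_self hv.1
  rw [residueForm_eq hv.1 hx hab, residueForm_eq (a := a) (b := b) (smul_mem_cone hv.1 c) ?_ ?_, hJ]
  · have h : rowDet (c • v) (fun i => c • x i + m i • v) a b = c ^ 4 * rowDet v x a b := by
      have e : Matrix.of ![c • v, c • x 0 + m 0 • v, c • x 1 + m 1 • v, c • x 2 + m 2 • v, a, b] =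
          !![c, 0, 0, 0, 0, 0; m 0, c, 0, 0, 0, 0; m 1, 0, c, 0, 0, 0; m 2, 0, 0, c, 0, 0;
            0, 0, 0, 0, 1, 0; 0, 0, 0, 0, 0, 1] * Matrix.of ![v, x 0, x 1, x 2, a, b] := by
        ext i j
        fin_cases i <;> simp [Matrix.mul_apply, Fin.sum_univ_six] <;> ring
      rw [rowDet, e, Matrix.det_mul, rowDet]
      congr 1
      rw [Matrix.det_of_isLowerTriangular]
      · simp [Fin.prod_univ_six]; ring
      · intro i j hij
        fin_cases i <;> fin_cases j <;> first | rfl | (exfalso; revert hij; decide)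
    rw [h, mul_div_mul_left _ _ (pow_ne_zero 4 hc)]
  · intro i
    have h1 := (hx i).1
    have h2 := (hx i).2
    have h3 := hvv.1
    have h4 := hvv.2
    simp only [SetLike.mem_coe, LinearMap.mem_ker] at h1 h2 h3 h4
    constructor <;> simp [diff_smul, h1, h2, h3, h4]
  · rw [hJ]; exact mul_ne_zero (pow_ne_zero 4 hc) hab

/-- In the chart `v₀ = 1` the residue form is `dv₃ ∧ dv₄ ∧ dv₅ / det (∂Aᵢ/∂vⱼ)`, `i, j = 1, 2`. -/
lemma residueForm_chart {v : V} (hv : v ∈ cone) (h0 : v 0 = 1) {x : Fin 3 → V}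
    (hx : ∀ i, x i ∈ coneTangent v) (hx0 : ∀ i, x i 0 = 0)
    (hJ : eval v (pderiv 1 A1) * eval v (pderiv 2 A2) -
      eval v (pderiv 2 A1) * eval v (pderiv 1 A2) ≠ 0) :
    residueForm v x = Matrix.det !![x 0 3, x 0 4, x 0 5; x 1 3, x 1 4, x 1 5; x 2 3, x 2 4, x 2 5] /
      (eval v (pderiv 1 A1) * eval v (pderiv 2 A2) -
        eval v (pderiv 2 A1) * eval v (pderiv 1 A2)) := by
  have hd (A : MvPolynomial (Fin 6) ℂ) (j : Fin 6) :
      diff A v (Pi.single j 1) = eval v (pderiv j A) := by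
    simp [diff, Pi.single_apply]
  have e : jac v (Pi.single 1 1) (Pi.single 2 1) =
      eval v (pderiv 1 A1) * eval v (pderiv 2 A2) -
      eval v (pderiv 2 A1) * eval v (pderiv 1 A2) := by
    simp only [jac, hd]
  rw [← e] at hJ ⊢
  rw [residueForm_eq hv hx hJ]
  congr 1
  rw [rowDet, Matrix.det_succ_column_zero, Matrix.det_fin_three]
  simp [Fin.sum_univ_succ, Matrix.det_succ_row_zero, h0, hx0, Fin.succAbove, Pi.single_apply]
  ring

end WellDefined

/-- The permutation `0 ↦ 3, 1 ↦ 4, 2 ↦ 0, 3 ↦ 5, 4 ↦ 2, 5 ↦ 1` of the coordinates. -/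
def perm : Equiv.Perm (Fin 6) where
  toFun := ![3, 4, 0, 5, 2, 1]
  invFun := ![2, 5, 4, 0, 1, 3]
  left_inv := by decide
  right_inv := by decide

/-- The linear automorphism `σ` of `ℂ⁶` with `v₀ ↦ v₃, v₁ ↦ v₄, v₂ ↦ v₀, v₃ ↦ v₅, v₄ ↦ v₂,
v₅ ↦ v₁`: the coordinate `v_i` of `σ v` is the coordinate `v_{perm i}` of `v`.  It acts on `ℙ⁵`
by `σ • p`. -/
def σ : V ≃ₗ[ℂ] V := LinearEquiv.funCongrLeft ℂ ℂ perm

section Manifold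

/-- The model space `ℂ³` of complex threefolds. -/
abbrev C3 : Type := EuclideanSpace ℂ (Fin 3)

variable (Y : Type*) [TopologicalSpace Y] [ChartedSpace C3 Y]

/-- Not necessarily continuous differential three-forms of type `(3,0)` on `Y`. -/
abbrev RoughForm : Type _ := ∀ y : Y, TangentSpace 𝓘(ℂ, C3) y [⋀^Fin 3]→L[ℂ] ℂ

variable {Y}

/-- The coefficient of a form in the preferred chart at `y₀`, as a function on `ℂ³`, with respect to
the constant vector fields `w₀, w₁, w₂`. -/
def chartCoeff (ω : RoughForm Y) (y₀ : Y) (w : Fin 3 → C3) (z : C3) : ℂ :=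
  ω ((extChartAt 𝓘(ℂ, C3) y₀).symm z)
    (fun i => mfderiv 𝓘(ℂ, C3) 𝓘(ℂ, C3) (extChartAt 𝓘(ℂ, C3) y₀).symm z (w i))

variable (Y) in
/-- `H^{3,0}(Y)`: the space of global holomorphic three-forms on the complex threefold `Y`, i.e. the
forms whose coefficients in charts are holomorphic. -/
def H30 : Submodule ℂ (RoughForm Y) where
  carrier := {ω | ∀ (y₀ : Y) (w : Fin 3 → C3),
    DifferentiableOn ℂ (chartCoeff ω y₀ w) (extChartAt 𝓘(ℂ, C3) y₀).target}
  add_mem' h₁ h₂ y₀ w := (h₁ y₀ w).add (h₂ y₀ w)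
  zero_mem' _ _ := differentiableOn_const 0
  smul_mem' c _ h y₀ w := (h y₀ w).const_smul c

/-- The pull-back of a form under a map `f : Y → Y`. -/
def pullback (f : Y → Y) (ω : RoughForm Y) : RoughForm Y := fun y =>
  (ω (f y)).compContinuousLinearMap (mfderiv 𝓘(ℂ, C3) 𝓘(ℂ, C3) f y)

/-- `L` is a holomorphic lift of `π : Y → ℙ⁵` to `ℂ⁶ ∖ {0}` near `y`. -/
def IsLocalLift (π : Y → P5) (L : Y → V) (y : Y) : Prop :=
  ∀ᶠ y' in 𝓝 y, MDifferentiableAt 𝓘(ℂ, C3) 𝓘(ℂ, V) L y' ∧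
    ∃ h : L y' ≠ 0, Projectivization.mk ℂ (L y') h = π y'

/-- `π : Y → ℙ⁵` is a resolution of singularities of `Y'`: a holomorphic map onto `Y'` which
is injective and immersive (hence biholomorphic) over the smooth locus of `Y'`, the preimage of
which is dense.  (Here `Y` is meant to be a compact complex threefold, so `π` is proper.) -/
structure IsResolution (π : Y → P5) : Prop where
  holomorphic : ∀ y, ∃ L, IsLocalLift π L y
  range_eq : Set.range π = Y'
  dense : Dense (π ⁻¹' Y'reg)
  injOn : Set.InjOn π (π ⁻¹' Y'reg)
  immersive : ∀ y, π y ∈ Y'reg → ∀ L, IsLocalLift π L y →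
    ∀ t : TangentSpace 𝓘(ℂ, C3) y, (∃ c : ℂ, mfderiv 𝓘(ℂ, C3) 𝓘(ℂ, V) L y t = c • L y) → t = 0

/-- `Ω` restricts over the smooth locus of `Y'` to the pull-back `π^* ω_{Y'}`. -/
def ExtendsResidue (π : Y → P5) (Ω : RoughForm Y) : Prop :=
  ∀ y, π y ∈ Y'reg → ∀ L, IsLocalLift π L y → ∀ t : Fin 3 → TangentSpace 𝓘(ℂ, C3) y,
    Ω y t = residueForm (L y) (fun i => mfderiv 𝓘(ℂ, C3) 𝓘(ℂ, V) L y (t i))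

/-- `π` is crepant, `K_Y = π^* K_{Y'}`.  The canonical sheaf of the complete intersection
`Y'` is trivial, generated by `ω_{Y'}`, so this says that `π^* ω_{Y'}` extends to a generator
of `K_Y`, i.e. to a nowhere vanishing holomorphic three-form on `Y`. -/
def IsCrepant (π : Y → P5) : Prop :=
  ∃ Ω ∈ H30 Y, (∀ y, Ω y ≠ 0) ∧ ExtendsResidue π Ω

end Manifold

end DelPezzoCY

end

/-! Substituting `σ` into the cubics sends `A1` to `-A2` and `A2` to `A1 - A2`. This 2×2 matrix has
determinant 1, so `dA₁ ∧ dA₂` is invariant (`jac_σ`). The coordinate permutation is a 6-cycle, hence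
odd, so the 6×6 determinant changes sign (`rowDet_σ`). The residue form, their quotient, therefore
changes sign (`residueForm_σ`).

On a crepant resolution, let `Ω` be the nowhere vanishing extension of the residue. Any holomorphic
3-form divided by `Ω` is a holomorphic function on a compact connected manifold, hence constant
(`exists_eq_smul_of_mem_H30`), so only `Ω` matters. Over the smooth locus the sign computation gives
`τ^* Ω = (-1)^k Ω` (`ExtendsResidue.pullback_eq`); density of that preimage and continuity of the
coefficients give it everywhere (`pullback_eq_smul_of_dense`). -/

namespace DelPezzoCY

/-! ### The sign of `σ` on the residue form, on the affine cone. -/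

section Symmetry

open MvPolynomial

lemma σ_apply (v : V) (i : Fin 6) : σ v i = v (perm i) := rfl

lemma σ_apply_vec (v : V) :
    σ v 0 = v 3 ∧ σ v 1 = v 4 ∧ σ v 2 = v 0 ∧ σ v 3 = v 5 ∧ σ v 4 = v 2 ∧ σ v 5 = v 1 :=
  ⟨rfl, rfl, rfl, rfl, rfl, rfl⟩

/-- Up to sign `σ` permutes the six cubics cyclically: `F1 ↦ -F2`, `F2 ↦ -F5`, `F5 ↦ -F7`, `F7 ↦
-F6`, `F6 ↦ -F3`, `F3 ↦ -F1`. This is also behind `eval_A2_σ`. -/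
lemma eval_A1_σ (v : V) : eval (σ v) A1 = -eval v A2 := by
  obtain ⟨h0, h1, h2, h3, h4, h5⟩ := σ_apply_vec v
  simp [A1, A2, F1, F2, F3, F5, F6, F7, h0, h1, h2, h3, h4, h5]
  ring

lemma eval_A2_σ (v : V) : eval (σ v) A2 = eval v A1 - eval v A2 := by
  obtain ⟨h0, h1, h2, h3, h4, h5⟩ := σ_apply_vec v
  simp [A1, A2, F1, F2, F3, F5, F6, F7, h0, h1, h2, h3, h4, h5]
  ring

lemma diff_A1_σ (v w : V) : diff A1 (σ v) (σ w) = -diff A2 v w := by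
  obtain ⟨h0, h1, h2, h3, h4, h5⟩ := σ_apply_vec v
  obtain ⟨k0, k1, k2, k3, k4, k5⟩ := σ_apply_vec w
  simp only [diff, Fin.sum_univ_six, LinearMap.add_apply, LinearMap.smul_apply,
    LinearMap.proj_apply, smul_eq_mul]
  simp [A1, A2, F1, F2, F3, F5, F6, F7, pderiv_X, Derivation.leibniz, Derivation.leibniz_pow,
    h0, h1, h2, h3, h4, h5, k0, k1, k2, k3, k4, k5]
  ring

lemma diff_A2_σ (v w : V) : diff A2 (σ v) (σ w) = diff A1 v w - diff A2 v w := by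
  obtain ⟨h0, h1, h2, h3, h4, h5⟩ := σ_apply_vec v
  obtain ⟨k0, k1, k2, k3, k4, k5⟩ := σ_apply_vec w
  simp only [diff, Fin.sum_univ_six, LinearMap.add_apply, LinearMap.smul_apply,
    LinearMap.proj_apply, smul_eq_mul]
  simp [A1, A2, F1, F2, F3, F5, F6, F7, pderiv_X, Derivation.leibniz, Derivation.leibniz_pow,
    h0, h1, h2, h3, h4, h5, k0, k1, k2, k3, k4, k5]
  ring

/-- The pair of differentials is transformed by a matrix of determinant 1. -/
lemma jac_σ (v a b : V) : jac (σ v) (σ a) (σ b) = jac v a b := by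
  simp only [jac, diff_A1_σ, diff_A2_σ]
  ring

lemma sign_perm : Equiv.Perm.sign perm = -1 := by decide

/-- Applying `σ` to every row permutes the columns by the odd permutation `perm`. -/
lemma rowDet_σ (v : V) (x : Fin 3 → V) (a b : V) :
    rowDet (σ v) (fun i => σ (x i)) (σ a) (σ b) = -rowDet v x a b := by
  have h : Matrix.of ![σ v, σ (x 0), σ (x 1), σ (x 2), σ a, σ b] =
      (Matrix.of ![v, x 0, x 1, x 2, a, b]).submatrix id perm := by
    funext i; fin_cases i <;> rfl
  rw [rowDet, h, Matrix.det_permute', sign_perm, rowDet]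
  simp

lemma σ_mem_cone {v : V} : σ v ∈ cone ↔ v ∈ cone := by
  change (eval (σ v) A1 = 0 ∧ eval (σ v) A2 = 0) ↔ (eval v A1 = 0 ∧ eval v A2 = 0)
  rw [eval_A1_σ, eval_A2_σ]
  constructor
  · rintro ⟨h, h'⟩
    exact ⟨by linear_combination h' - h, by linear_combination -h⟩
  · rintro ⟨h, h'⟩
    exact ⟨by linear_combination -h', by linear_combination h - h'⟩

/-- A non-zero minor is easier to transport than linear independence: minors are invariant under `σ`
and scale by a fourth power. -/
lemma mem_smoothCone_iff {v : V} : v ∈ smoothCone ↔ v ∈ cone ∧ ∃ a b, jac v a b ≠ 0 := by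
  refine ⟨fun h => ⟨h.1, exists_jac_ne_zero h⟩, fun ⟨hv, a, b, hab⟩ => ⟨hv, ?_⟩⟩
  rw [LinearIndependent.pair_iff]
  intro s t hst
  have ha := LinearMap.congr_fun hst a
  have hb := LinearMap.congr_fun hst b
  simp only [LinearMap.add_apply, LinearMap.smul_apply, smul_eq_mul, LinearMap.zero_apply] at ha hb
  unfold jac at hab
  -- Cramer's rule for the coefficients `s`, `t`, with determinant `jac v a b`.
  constructor <;> refine (mul_eq_zero.1 ?_).resolve_right hab
  · linear_combination diff A2 v b * ha - diff A2 v a * hb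
  · linear_combination diff A1 v a * hb - diff A1 v b * ha

lemma σ_mem_smoothCone {v : V} : σ v ∈ smoothCone ↔ v ∈ smoothCone := by
  rw [mem_smoothCone_iff, mem_smoothCone_iff, σ_mem_cone]
  refine and_congr_right fun _ => ⟨?_, ?_⟩
  · rintro ⟨a, b, h⟩
    refine ⟨σ.symm a, σ.symm b, ?_⟩
    rwa [← jac_σ, σ.apply_symm_apply, σ.apply_symm_apply]
  · rintro ⟨a, b, h⟩
    exact ⟨σ a, σ b, by rwa [jac_σ]⟩

lemma σ_mem_coneTangent {v w : V} (h : w ∈ coneTangent v) : σ w ∈ coneTangent (σ v) := by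
  have h1 : diff A1 v w = 0 := h.1
  have h2 : diff A2 v w = 0 := h.2
  refine ⟨?_, ?_⟩
  · change diff A1 (σ v) (σ w) = 0
    rw [diff_A1_σ, h2, neg_zero]
  · change diff A2 (σ v) (σ w) = 0
    rw [diff_A2_σ, h1, h2, sub_zero]

/-- Since `residueForm` does not depend on the auxiliary pair, it can be computed with `(a, b)` at
`v` and with `(σ a, σ b)` at `σ v`. -/
lemma residueForm_σ {v : V} (hv : v ∈ smoothCone) {x : Fin 3 → V}
    (hx : ∀ i, x i ∈ coneTangent v) :
    residueForm (σ v) (fun i => σ (x i)) = -residueForm v x := by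
  obtain ⟨a, b, hab⟩ := exists_jac_ne_zero hv
  have hab' : jac (σ v) (σ a) (σ b) ≠ 0 := by rwa [jac_σ]
  rw [residueForm_eq hv.1 hx hab,
    residueForm_eq (σ_mem_cone.2 hv.1) (fun i => σ_mem_coneTangent (hx i)) hab',
    rowDet_σ, jac_σ, neg_div]

lemma σ_pow_succ_apply (k : ℕ) (v : V) : (σ ^ (k + 1)) v = σ ((σ ^ k) v) := by
  rw [pow_succ']; rfl

lemma σ_pow_mem_smoothCone (k : ℕ) {v : V} : (σ ^ k) v ∈ smoothCone ↔ v ∈ smoothCone := by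
  induction k with
  | zero => rfl
  | succ k ih => rw [σ_pow_succ_apply, σ_mem_smoothCone, ih]

lemma σ_pow_mem_coneTangent (k : ℕ) {v w : V} (h : w ∈ coneTangent v) :
    (σ ^ k) w ∈ coneTangent ((σ ^ k) v) := by
  induction k with
  | zero => exact h
  | succ k ih => rw [σ_pow_succ_apply, σ_pow_succ_apply]; exact σ_mem_coneTangent ih

lemma residueForm_σ_pow (k : ℕ) {v : V} (hv : v ∈ smoothCone) {x : Fin 3 → V}
    (hx : ∀ i, x i ∈ coneTangent v) :
    residueForm ((σ ^ k) v) (fun i => (σ ^ k) (x i)) = (-1) ^ k * residueForm v x := by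
  induction k with
  | zero => simp
  | succ k ih =>
    simp only [σ_pow_succ_apply]
    rw [residueForm_σ ((σ_pow_mem_smoothCone k).2 hv) fun i => σ_pow_mem_coneTangent k (hx i), ih]
    ring

end Symmetry

/-! ### Passage from the cone to projective space, and the order of `σ`. -/

section Projective

lemma smul_mem_cone_iff {v : V} {c : ℂ} (hc : c ≠ 0) : c • v ∈ cone ↔ v ∈ cone := by
  refine ⟨fun h => ?_, fun h => smul_mem_cone h c⟩
  simpa [smul_smul, inv_mul_cancel₀ hc] using smul_mem_cone h c⁻¹

lemma smul_mem_smoothCone_iff {v : V} {c : ℂ} (hc : c ≠ 0) :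
    c • v ∈ smoothCone ↔ v ∈ smoothCone := by
  have hJ (a b : V) : jac (c • v) a b = c ^ 4 * jac v a b := by
    simp only [jac, (diff_smul c v _).1, (diff_smul c v _).2]; ring
  simp only [mem_smoothCone_iff, smul_mem_cone_iff hc, hJ, mul_ne_zero_iff, ne_eq,
    pow_eq_zero_iff, hc, not_false_eq_true, true_and, OfNat.ofNat_ne_zero]

/-- `Y'` and `Y'reg` are defined through the chosen representative `rep`; homogeneity makes that
choice harmless. -/
lemma exists_rep_mk_eq_smul {v : V} (hv : v ≠ 0) :
    ∃ c : ℂ, c ≠ 0 ∧ (Projectivization.mk ℂ v hv).rep = c • v := by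
  obtain ⟨a, ha⟩ := Projectivization.exists_smul_eq_mk_rep ℂ v hv
  exact ⟨a, a.ne_zero, ha.symm⟩

lemma mk_mem_Y' {v : V} (hv : v ≠ 0) : Projectivization.mk ℂ v hv ∈ Y' ↔ v ∈ cone := by
  obtain ⟨c, hc, h⟩ := exists_rep_mk_eq_smul hv
  change (Projectivization.mk ℂ v hv).rep ∈ cone ↔ _
  rw [h, smul_mem_cone_iff hc]

lemma mk_mem_Y'reg {v : V} (hv : v ≠ 0) :
    Projectivization.mk ℂ v hv ∈ Y'reg ↔ v ∈ smoothCone := by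
  obtain ⟨c, hc, h⟩ := exists_rep_mk_eq_smul hv
  change (Projectivization.mk ℂ v hv).rep ∈ smoothCone ↔ _
  rw [h, smul_mem_smoothCone_iff hc]

lemma σ_smul_mem_Y' (p : P5) : σ • p ∈ Y' ↔ p ∈ Y' := by
  induction p using Projectivization.ind with
  | h v hv =>
    rw [Projectivization.smul_mk, mk_mem_Y', mk_mem_Y']
    exact σ_mem_cone

lemma σ_smul_mem_Y'reg (p : P5) : σ • p ∈ Y'reg ↔ p ∈ Y'reg := by
  induction p using Projectivization.ind with
  | h v hv =>
    rw [Projectivization.smul_mk, mk_mem_Y'reg, mk_mem_Y'reg]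
    exact σ_mem_smoothCone

lemma σ_pow_smul_mem_Y'reg (k : ℕ) (p : P5) : σ ^ k • p ∈ Y'reg ↔ p ∈ Y'reg := by
  induction k with
  | zero => simp
  | succ k ih => rw [pow_succ', mul_smul, σ_smul_mem_Y'reg, ih]

lemma σ_pow_apply (k : ℕ) (v : V) (i : Fin 6) : (σ ^ k) v i = v ((perm ^ k) i) := by
  induction k generalizing i with
  | zero => rfl
  | succ k ih => rw [σ_pow_succ_apply, σ_apply, ih, pow_succ]; rfl

lemma perm_pow_zero_eq_zero_iff (k : ℕ) : (perm ^ k) 0 = 0 ↔ 6 ∣ k := by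
  have h6 : perm ^ 6 = 1 := by decide
  have h : perm ^ k = perm ^ (k % 6) := by
    conv_lhs => rw [← Nat.div_add_mod k 6, pow_add, pow_mul, h6, one_pow, one_mul]
  rw [h, Nat.dvd_iff_mod_eq_zero]
  have : k % 6 < 6 := Nat.mod_lt _ (by norm_num)
  generalize k % 6 = r at this ⊢
  interval_cases r <;> decide

lemma σ_pow_smul_eq_self_iff (k : ℕ) : (∀ p ∈ Y', σ ^ k • p = p) ↔ 6 ∣ k := by
  constructor
  · intro h
    -- The coordinate point `[1:0:0:0:0:0]` lies on `Y'`, since no pure cube occurs in the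
    -- equations, and its orbit under the 6-cycle has length six.
    have hne : (Pi.single 0 1 : V) ≠ 0 := by simp
    have hmem : (Pi.single 0 1 : V) ∈ cone := by
      constructor <;> simp [A1, A2, F1, F2, F3, F5, F6, F7]
    have h0 := h _ ((mk_mem_Y' hne).2 hmem)
    rw [Projectivization.smul_mk, Projectivization.mk_eq_mk_iff'] at h0
    obtain ⟨c, hc⟩ := h0
    rw [← perm_pow_zero_eq_zero_iff]
    by_contra hk
    -- If `perm ^ k` moves 0, coordinate 0 of `c • e₀ = σ ^ k e₀` forces `c = 0`, while the
    -- coordinate sent to 0 by `perm ^ k` reads `0 = 1`.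
    have e : c * 1 = (Pi.single 0 1 : V) ((perm ^ k) 0) :=
      (congr_fun hc 0).trans (σ_pow_apply k _ 0)
    have e' : c * (Pi.single 0 1 : V) ((perm ^ k).symm 0) =
        (Pi.single 0 1 : V) ((perm ^ k) ((perm ^ k).symm 0)) :=
      (congr_fun hc _).trans (σ_pow_apply k _ _)
    rw [mul_one, Pi.single_eq_of_ne hk] at e
    simp [e] at e'
  · rintro ⟨m, rfl⟩ p -
    have h6 : σ ^ 6 = 1 := by
      refine LinearEquiv.ext fun v => funext fun i => ?_
      rw [σ_pow_apply, show perm ^ 6 = 1 by decide]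
      rfl
    rw [pow_mul, h6, one_pow, one_smul]

end Projective

/-! ### Continuity of derivatives, by one-variable Cauchy estimates. -/

/-- The directional derivatives of a holomorphic map are continuous. -/
lemma continuousAt_fderiv_apply {E G : Type*} [NormedAddCommGroup E] [NormedSpace ℂ E]
    [NormedAddCommGroup G] [NormedSpace ℂ G] {F : E → G} {U : Set E} {z₀ : E}
    (hU : U ∈ 𝓝 z₀) (hF : ∀ z ∈ U, DifferentiableAt ℂ F z) (w : E) :
    ContinuousAt (fun z => fderiv ℂ F z w) z₀ := by
  obtain ⟨ρ, hρ, hball⟩ := Metric.mem_nhds_iff.1 hU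
  -- The disc `z + t • w`, `‖t‖ ≤ R`, stays in the `ρ`-ball for `z` in the `ρ / 2`-ball; the `+ 1`
  -- covers `w = 0`.
  set R : ℝ := ρ / 2 / (‖w‖ + 1) with hRdef
  have hw : 0 < ‖w‖ + 1 := by positivity
  have hR : 0 < R := by positivity
  have hRw : R * ‖w‖ < ρ / 2 := by
    have : R * (‖w‖ + 1) = ρ / 2 := by rw [hRdef]; field_simp
    nlinarith
  have hmem : ∀ z ∈ Metric.ball z₀ (ρ / 2), ∀ t ∈ Metric.closedBall (0 : ℂ) R, z + t • w ∈ U := by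
    intro z hz t ht
    refine hball ?_
    rw [mem_ball_iff_norm] at hz ⊢
    rw [mem_closedBall_zero_iff] at ht
    calc ‖z + t • w - z₀‖ = ‖(z - z₀) + t • w‖ := by congr 1; abel
      _ ≤ ‖z - z₀‖ + ‖t‖ * ‖w‖ := (norm_add_le _ _).trans_eq (by rw [norm_smul])
      _ ≤ ‖z - z₀‖ + R * ‖w‖ := by gcongr
      _ < ρ := by linarith
  have hderiv : ∀ z ∈ Metric.ball z₀ (ρ / 2), ∀ t ∈ Metric.closedBall (0 : ℂ) R,
      HasDerivAt (fun t : ℂ => F (z + t • w)) (fderiv ℂ F (z + t • w) w) t := by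
    intro z hz t ht
    have h1 : HasDerivAt (fun t : ℂ => z + t • w) w t := by
      simpa using ((hasDerivAt_id t).smul_const w).const_add z
    exact (hF _ (hmem z hz t ht)).hasFDerivAt.comp_hasDerivAt t h1
  have hz₀ : z₀ ∈ Metric.ball z₀ (ρ / 2) := Metric.mem_ball_self (by positivity)
  have h0 : (0 : ℂ) ∈ Metric.closedBall (0 : ℂ) R := Metric.mem_closedBall_self hR.le
  rw [Metric.continuousAt_iff']
  intro ε hε
  -- Compactness of the disc makes the estimate uniform in `t`.
  have hunif : ∀ᶠ z in 𝓝 z₀, ∀ t ∈ Metric.closedBall (0 : ℂ) R,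
      ‖F (z + t • w) - F (z₀ + t • w)‖ < ε / 2 * R := by
    refine (isCompact_closedBall (0 : ℂ) R).eventually_forall_of_forall_eventually fun t ht => ?_
    have hc : ContinuousAt F (z₀ + t • w) := (hF _ (hmem z₀ hz₀ t ht)).continuousAt
    have hcont : ContinuousAt
        (fun p : E × ℂ => ‖F (p.1 + p.2 • w) - F (z₀ + p.2 • w)‖) (z₀, t) := by
      refine ContinuousAt.norm (ContinuousAt.sub ?_ ?_)
      · exact ContinuousAt.comp (f := fun p : E × ℂ => p.1 + p.2 • w) hc (by fun_prop)
      · exact ContinuousAt.comp (f := fun p : E × ℂ => z₀ + p.2 • w) hc (by fun_prop)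
    refine hcont.eventually_lt continuousAt_const ?_
    simp only [sub_self, norm_zero]
    positivity
  filter_upwards [hunif, Metric.ball_mem_nhds z₀ (by positivity : 0 < ρ / 2)] with z hz hzb
  have hd : ∀ t ∈ Metric.closedBall (0 : ℂ) R,
      HasDerivAt (fun t : ℂ => F (z + t • w) - F (z₀ + t • w))
        (fderiv ℂ F (z + t • w) w - fderiv ℂ F (z₀ + t • w) w) t :=
    fun t ht => (hderiv z hzb t ht).sub (hderiv z₀ hz₀ t ht)
  have hcl : DiffContOnCl ℂ (fun t : ℂ => F (z + t • w) - F (z₀ + t • w)) (Metric.ball 0 R) := by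
    refine DifferentiableOn.diffContOnCl fun t ht => ?_
    exact (hd t (Metric.closure_ball_subset_closedBall ht)).differentiableAt.differentiableWithinAt
  -- Cauchy's estimate at the centre of the disc bounds the difference of the derivatives by `(ε / 2
  -- * R) / R`.
  have hle := Complex.norm_deriv_le_of_forall_mem_sphere_norm_le hR hcl
    fun t ht => (hz t (Metric.sphere_subset_closedBall ht)).le
  rw [(hd 0 h0).deriv, mul_div_assoc, div_self hR.ne', mul_one] at hle
  simp only [zero_smul, add_zero] at hle
  rw [dist_eq_norm]
  linarith

/-! ### Top-degree forms on `ℂ³` form a line. -/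

section Alternating

/-- The standard basis of `ℂ³`. -/
noncomputable abbrev stdBasis : Module.Basis (Fin 3) ℂ C3 :=
  (EuclideanSpace.basisFun (Fin 3) ℂ).toBasis

lemma topForm_eq (α : C3 [⋀^Fin 3]→L[ℂ] ℂ) (e : Module.Basis (Fin 3) ℂ C3) (t : Fin 3 → C3) :
    α t = α e * e.det t := by
  simpa using congrArg (fun f : C3 [⋀^Fin 3]→ₗ[ℂ] ℂ => f t)
    (α.toAlternatingMap.eq_smul_basis_det e)

lemma topForm_eq_smul_of_basis {α β : C3 [⋀^Fin 3]→L[ℂ] ℂ} {c : ℂ}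
    (e : Module.Basis (Fin 3) ℂ C3) (h : α e = c * β e) : α = c • β := by
  ext t
  rw [ContinuousAlternatingMap.smul_apply, topForm_eq α e, topForm_eq β e, h, smul_eq_mul,
    mul_assoc]

lemma exists_topForm_eq_smul (α : C3 [⋀^Fin 3]→L[ℂ] ℂ) {β : C3 [⋀^Fin 3]→L[ℂ] ℂ} (hβ : β ≠ 0) :
    ∃ c : ℂ, α = c • β := by
  have hne : β stdBasis ≠ 0 := fun h => hβ <|
    (topForm_eq_smul_of_basis (α := β) (β := 0) (c := 0) stdBasis
      (by rw [h, zero_mul])).trans (ContinuousAlternatingMap.ext fun _ => zero_mul _)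
  exact ⟨α stdBasis / β stdBasis, topForm_eq_smul_of_basis stdBasis (by field_simp)⟩

end Alternating

/-! ### Holomorphic 3-forms in charts. -/

section Charts

variable {Y : Type*} [TopologicalSpace Y] [ChartedSpace C3 Y]

lemma chartCoeff_eq_mul_det (ω : RoughForm Y) (y₀ : Y) (w : Fin 3 → C3) (z : C3) :
    chartCoeff ω y₀ w z = chartCoeff ω y₀ stdBasis z * stdBasis.det w :=
  topForm_eq ((ω ((extChartAt 𝓘(ℂ, C3) y₀).symm z)).compContinuousLinearMap
    (mfderiv 𝓘(ℂ, C3) 𝓘(ℂ, C3) (extChartAt 𝓘(ℂ, C3) y₀).symm z)) stdBasis w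

variable [IsManifold 𝓘(ℂ, C3) 1 Y]

lemma mdifferentiableAt_extChartAt_symm {y₀ : Y} {z : C3}
    (hz : z ∈ (extChartAt 𝓘(ℂ, C3) y₀).target) :
    MDifferentiableAt 𝓘(ℂ, C3) 𝓘(ℂ, C3) (extChartAt 𝓘(ℂ, C3) y₀).symm z := by
  have h := mdifferentiableWithinAt_extChartAt_symm hz
  rwa [ModelWithCorners.range_eq_univ, mdifferentiableWithinAt_univ] at h

lemma isInvertible_mfderiv_extChartAt_symm {y₀ : Y} {z : C3}
    (hz : z ∈ (extChartAt 𝓘(ℂ, C3) y₀).target) :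
    (mfderiv 𝓘(ℂ, C3) 𝓘(ℂ, C3) (extChartAt 𝓘(ℂ, C3) y₀).symm z).IsInvertible := by
  simpa using isInvertible_mfderivWithin_extChartAt_symm hz

/-- The derivative of the inverse chart is invertible, so it carries the standard basis to a basis
of the tangent space, and one coefficient determines a 3-form at a point. -/
lemma eq_smul_of_chartCoeff_eq {α β : RoughForm Y} {c : ℂ} {y₀ : Y} {z : C3}
    (hz : z ∈ (extChartAt 𝓘(ℂ, C3) y₀).target)
    (h : chartCoeff α y₀ stdBasis z = c * chartCoeff β y₀ stdBasis z) :
    α ((extChartAt 𝓘(ℂ, C3) y₀).symm z) = c • β ((extChartAt 𝓘(ℂ, C3) y₀).symm z) := by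
  obtain ⟨A, hA⟩ := isInvertible_mfderiv_extChartAt_symm hz
  refine topForm_eq_smul_of_basis (stdBasis.map (A : C3 ≃L[ℂ] C3).toLinearEquiv) ?_
  have hb : ∀ γ : RoughForm Y, chartCoeff γ y₀ stdBasis z =
      (γ ((extChartAt 𝓘(ℂ, C3) y₀).symm z) : C3 [⋀^Fin 3]→L[ℂ] ℂ)
        (stdBasis.map (A : C3 ≃L[ℂ] C3).toLinearEquiv) := by
    intro γ
    rw [chartCoeff, ← hA]
    congr 1
  exact (hb α).symm.trans (h.trans (congrArg (c * ·) (hb β)))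

lemma chartCoeff_ne_zero {Ω : RoughForm Y} {y₀ : Y} {z : C3}
    (hz : z ∈ (extChartAt 𝓘(ℂ, C3) y₀).target)
    (h : Ω ((extChartAt 𝓘(ℂ, C3) y₀).symm z) ≠ 0) : chartCoeff Ω y₀ stdBasis z ≠ 0 := by
  intro h0
  apply h
  exact (eq_smul_of_chartCoeff_eq (α := Ω) (β := Ω) (c := 0) hz (by rw [h0, mul_zero])).trans
    (ContinuousAlternatingMap.ext fun _ => zero_mul _)

/-- On a compact connected complex threefold, a holomorphic three-form is a constant multiple of any
nowhere vanishing one. -/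
lemma exists_eq_smul_of_mem_H30 [CompactSpace Y] [ConnectedSpace Y] {ω Ω : RoughForm Y}
    (hω : ω ∈ H30 Y) (hΩ : Ω ∈ H30 Y) (hne : ∀ y, Ω y ≠ 0) : ∃ c : ℂ, ω = c • Ω := by
  have hex : ∀ y, ∃ c : ℂ, ω y = c • Ω y := fun y => exists_topForm_eq_smul (ω y) (hne y)
  choose f hf using hex
  have hcoeff : ∀ (y₀ : Y) (z : C3), chartCoeff ω y₀ stdBasis z =
      f ((extChartAt 𝓘(ℂ, C3) y₀).symm z) * chartCoeff Ω y₀ stdBasis z := by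
    intro y₀ z
    simp only [chartCoeff]
    rw [hf]
    rfl
  -- In a chart the ratio `f` is a quotient of two holomorphic coefficients, the denominator being
  -- non-zero.
  have hdiff : MDifferentiable 𝓘(ℂ, C3) 𝓘(ℂ, ℂ) f := by
    intro y₀
    have hy₀ := mem_extChartAt_target (I := 𝓘(ℂ, C3)) y₀
    have htarget := extChartAt_target_mem_nhds (I := 𝓘(ℂ, C3)) y₀
    have hd : DifferentiableAt ℂ (f ∘ (extChartAt 𝓘(ℂ, C3) y₀).symm)
        (extChartAt 𝓘(ℂ, C3) y₀ y₀) := by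
      have hq : DifferentiableAt ℂ
          (fun z => chartCoeff ω y₀ stdBasis z * (chartCoeff Ω y₀ stdBasis z)⁻¹)
          (extChartAt 𝓘(ℂ, C3) y₀ y₀) :=
        ((hω y₀ stdBasis).differentiableAt htarget).mul
          (((hΩ y₀ stdBasis).differentiableAt htarget).inv (chartCoeff_ne_zero hy₀ (hne _)))
      refine hq.congr_of_eventuallyEq ?_
      filter_upwards [htarget] with z hz
      rw [hcoeff, mul_inv_cancel_right₀ (chartCoeff_ne_zero hz (hne _))]
      rfl
    have hm : MDifferentiableAt 𝓘(ℂ, C3) 𝓘(ℂ, ℂ)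
        ((f ∘ (extChartAt 𝓘(ℂ, C3) y₀).symm) ∘ extChartAt 𝓘(ℂ, C3) y₀) y₀ :=
      hd.mdifferentiableAt.comp y₀ (mdifferentiableAt_extChartAt (mem_chart_source C3 y₀))
    refine hm.congr_of_eventuallyEq ?_
    filter_upwards [extChartAt_source_mem_nhds (I := 𝓘(ℂ, C3)) y₀] with y hy
    exact congrArg f ((extChartAt 𝓘(ℂ, C3) y₀).left_inv hy).symm
  obtain ⟨c, hc⟩ := hdiff.exists_eq_const_of_compactSpace
  refine ⟨c, funext fun y => ?_⟩
  rw [hf y, hc]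
  rfl

/-- The coefficients of the pull-back of a holomorphic three-form are continuous. -/
lemma continuousAt_chartCoeff_pullback {Ω : RoughForm Y} (hΩ : Ω ∈ H30 Y) {τ : Y → Y}
    (hτ : MDifferentiable 𝓘(ℂ, C3) 𝓘(ℂ, C3) τ) (y₀ : Y) :
    ContinuousAt (chartCoeff (pullback τ Ω) y₀ stdBasis) (extChartAt 𝓘(ℂ, C3) y₀ y₀) := by
  set e₀ := extChartAt 𝓘(ℂ, C3) y₀
  set e₁ := extChartAt 𝓘(ℂ, C3) (τ y₀) with he₁
  set z₀ := e₀ y₀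
  set F : C3 → C3 := e₁ ∘ τ ∘ e₀.symm with hFdef
  have hz₀t : z₀ ∈ e₀.target := mem_extChartAt_target y₀
  have hsymm : e₀.symm z₀ = y₀ := e₀.left_inv (mem_extChartAt_source y₀)
  have hcont : ContinuousAt (τ ∘ e₀.symm) z₀ :=
    (hτ _).continuousAt.comp (mdifferentiableAt_extChartAt_symm hz₀t).continuousAt
  set U : Set C3 := {z | z ∈ e₀.target ∧ τ (e₀.symm z) ∈ e₁.source}
  have hU : U ∈ 𝓝 z₀ := by
    refine Filter.inter_mem (extChartAt_target_mem_nhds y₀) (hcont ?_)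
    simp only [Function.comp_apply, hsymm]
    exact extChartAt_source_mem_nhds (τ y₀)
  have hcomp : ∀ z ∈ U, MDifferentiableAt 𝓘(ℂ, C3) 𝓘(ℂ, C3) (τ ∘ e₀.symm) z := fun z hz =>
    (hτ _).comp z (mdifferentiableAt_extChartAt_symm hz.1)
  have hFm : ∀ z ∈ U, MDifferentiableAt 𝓘(ℂ, C3) 𝓘(ℂ, C3) F z := fun z hz =>
    (mdifferentiableAt_extChartAt (by simpa [he₁] using hz.2)).comp z (hcomp z hz)
  have hFd : ∀ z ∈ U, DifferentiableAt ℂ F z := fun z hz =>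
    mdifferentiableAt_iff_differentiableAt.1 (hFm z hz)
  have hFz₀ : F z₀ = e₁ (τ y₀) := by simp [hFdef, hsymm]
  -- The chain rule below compares germs at `z`, so `U` must be a neighbourhood of `z`, not merely
  -- contain it.
  have hUU : ∀ᶠ z in 𝓝 z₀, U ∈ 𝓝 z := eventually_mem_nhds_iff.2 hU
  -- Change of variables: the coefficient of `Ω` at `F z` times the Jacobian determinant of `F`, the
  -- expression of `τ` in charts.
  have key : ∀ᶠ z in 𝓝 z₀, chartCoeff (pullback τ Ω) y₀ stdBasis z =
      chartCoeff Ω (τ y₀) stdBasis (F z) *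
        stdBasis.det (fun i => fderiv ℂ F z (stdBasis i)) := by
    filter_upwards [hUU] with z hzU
    have hz : z ∈ U := mem_of_mem_nhds hzU
    rw [← chartCoeff_eq_mul_det]
    have hFt : F z ∈ e₁.target := e₁.map_source hz.2
    have hback : e₁.symm (F z) = τ (e₀.symm z) := e₁.left_inv hz.2
    have heq : τ ∘ e₀.symm =ᶠ[𝓝 z] e₁.symm ∘ F := by
      filter_upwards [hzU] with z' hz'
      exact (e₁.left_inv hz'.2).symm
    have hmf := heq.mfderiv_eq (I := 𝓘(ℂ, C3)) (I' := 𝓘(ℂ, C3))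
    rw [mfderiv_comp z (hτ _) (mdifferentiableAt_extChartAt_symm hz.1),
      mfderiv_comp z (mdifferentiableAt_extChartAt_symm hFt) (hFm z hz),
      mfderiv_eq_fderiv] at hmf
    have hform : ∀ {p q : Y} (_ : p = q) (t : Fin 3 → C3),
        (Ω p : C3 [⋀^Fin 3]→L[ℂ] ℂ) t = (Ω q : C3 [⋀^Fin 3]→L[ℂ] ℂ) t := by
      rintro p _ rfl t; rfl
    refine (hform hback.symm _).trans ?_
    refine congrArg (Ω (e₁.symm (F z)) : C3 [⋀^Fin 3]→L[ℂ] ℂ) (funext fun i => ?_)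
    exact congrArg (fun A : C3 →L[ℂ] C3 => A (stdBasis i)) hmf
  refine ContinuousAt.congr ?_ (key.mono fun _ h => h.symm)
  refine ContinuousAt.mul ?_ ?_
  · refine ContinuousAt.comp (g := chartCoeff Ω (τ y₀) stdBasis) ?_
      (hFd z₀ (mem_of_mem_nhds hU)).continuousAt
    rw [hFz₀]
    exact ((hΩ (τ y₀) stdBasis).differentiableAt (extChartAt_target_mem_nhds _)).continuousAt
  · have hdet : Continuous fun t : Fin 3 → C3 => stdBasis.det t := by
      simp only [Module.Basis.det_apply]
      refine Continuous.matrix_det ?_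
      refine continuous_matrix fun i j => ?_
      simp only [Module.Basis.toMatrix_apply, OrthonormalBasis.coe_toBasis_repr_apply,
        EuclideanSpace.basisFun_repr]
      fun_prop
    exact hdet.continuousAt.comp
      (continuousAt_pi.2 fun i => continuousAt_fderiv_apply hU hFd (stdBasis i))

/-- If a holomorphic three-form `Ω` satisfies `τ^* Ω = c Ω` on a dense set, then everywhere. -/
lemma pullback_eq_smul_of_dense {Ω : RoughForm Y} (hΩ : Ω ∈ H30 Y) {τ : Y → Y}
    (hτ : MDifferentiable 𝓘(ℂ, C3) 𝓘(ℂ, C3) τ) {S : Set Y} (hS : Dense S) {c : ℂ}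
    (h : ∀ y ∈ S, pullback τ Ω y = c • Ω y) : pullback τ Ω = c • Ω := by
  funext y₀
  have hsrc := mem_extChartAt_source (I := 𝓘(ℂ, C3)) y₀
  have hsymm := (extChartAt 𝓘(ℂ, C3) y₀).left_inv hsrc
  have hcont : ContinuousAt (fun y => chartCoeff (pullback τ Ω) y₀ stdBasis
      (extChartAt 𝓘(ℂ, C3) y₀ y) - c * chartCoeff Ω y₀ stdBasis (extChartAt 𝓘(ℂ, C3) y₀ y)) y₀ := by
    refine ContinuousAt.comp (g := fun z => chartCoeff (pullback τ Ω) y₀ stdBasis z -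
      c * chartCoeff Ω y₀ stdBasis z) ?_ (continuousAt_extChartAt y₀)
    exact (continuousAt_chartCoeff_pullback hΩ hτ y₀).sub (continuousAt_const.mul
      ((hΩ y₀ stdBasis).differentiableAt (extChartAt_target_mem_nhds _)).continuousAt)
  -- The difference of coefficients vanishes at points of `S` arbitrarily close to `y₀`, hence at
  -- `y₀` by continuity.
  have hfreq : ∃ᶠ y in 𝓝 y₀, chartCoeff (pullback τ Ω) y₀ stdBasis (extChartAt 𝓘(ℂ, C3) y₀ y) -
      c * chartCoeff Ω y₀ stdBasis (extChartAt 𝓘(ℂ, C3) y₀ y) ∈ ({0} : Set ℂ) := by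
    refine ((mem_closure_iff_frequently.1 (hS y₀)).and_eventually
      (extChartAt_source_mem_nhds (I := 𝓘(ℂ, C3)) y₀)).mono ?_
    rintro y ⟨hy, hys⟩
    rw [Set.mem_singleton_iff, sub_eq_zero]
    have hy' : (extChartAt 𝓘(ℂ, C3) y₀).symm (extChartAt 𝓘(ℂ, C3) y₀ y) ∈ S := by
      rwa [(extChartAt 𝓘(ℂ, C3) y₀).left_inv hys]
    simp only [chartCoeff]
    rw [h _ hy']
    rfl
  have h0 := isClosed_singleton.mem_of_frequently_of_tendsto hfreq hcont
  rw [Set.mem_singleton_iff, sub_eq_zero] at h0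
  have := eq_smul_of_chartCoeff_eq (mem_extChartAt_target y₀) h0
  rw [hsymm] at this
  exact this

end Charts

/-! ### Local lifts to the cone and the action of `τ` over the smooth locus. -/

section Lift

open MvPolynomial

/-- `diff A v` is the derivative at `v` of the polynomial function `A`. -/
lemma hasFDerivAt_eval (A : MvPolynomial (Fin 6) ℂ) (v : V) :
    HasFDerivAt (fun v : V => eval v A) (LinearMap.toContinuousLinearMap (diff A v)) v := by
  induction A using MvPolynomial.induction_on with
  | C a =>
    have h : LinearMap.toContinuousLinearMap (diff (C a) v) = 0 := by
      ext w; simp [diff]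
    simpa [h] using hasFDerivAt_const a v
  | add p q hp hq =>
    have h : LinearMap.toContinuousLinearMap (diff (p + q) v) =
        LinearMap.toContinuousLinearMap (diff p v) + LinearMap.toContinuousLinearMap (diff q v) := by
      ext w; simp [diff, Finset.sum_add_distrib, add_mul]
    rw [h]
    exact (hp.add hq).congr_of_eventuallyEq (.of_forall fun _ => map_add _ _ _)
  | mul_X p n hp =>
    have hX : HasFDerivAt (fun v : V => v n) (ContinuousLinearMap.proj n : V →L[ℂ] ℂ) v :=
      (ContinuousLinearMap.proj n : V →L[ℂ] ℂ).hasFDerivAt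
    have h : LinearMap.toContinuousLinearMap (diff (p * X n) v) =
        eval v p • (ContinuousLinearMap.proj n : V →L[ℂ] ℂ) +
          v n • LinearMap.toContinuousLinearMap (diff p v) := by
      refine ContinuousLinearMap.ext fun w => ?_
      simp [diff, Derivation.leibniz, pderiv_X, Finset.sum_add_distrib, add_mul, Finset.mul_sum,
        Pi.single_apply, mul_assoc, apply_ite (eval v)]
    rw [h]
    exact (hp.mul hX).congr_of_eventuallyEq (.of_forall fun _ => by simp)

variable {Y : Type*} [TopologicalSpace Y] [ChartedSpace C3 Y] {π : Y → P5} {L : Y → V} {y : Y}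

lemma IsLocalLift.mdifferentiableAt (h : IsLocalLift π L y) :
    MDifferentiableAt 𝓘(ℂ, C3) 𝓘(ℂ, V) L y := h.self_of_nhds.1

lemma IsLocalLift.mem_smoothCone (h : IsLocalLift π L y) (hy : π y ∈ Y'reg) :
    L y ∈ smoothCone := by
  obtain ⟨-, hne, hL⟩ := h.self_of_nhds
  rwa [← mk_mem_Y'reg hne, hL]

/-- Near `y` the lift takes values in the cone, so each `Aᵢ ∘ L` is locally zero, and the chain rule
gives the claim. -/
lemma IsLocalLift.mfderiv_mem_coneTangent (h : IsLocalLift π L y) (hπ : ∀ y', π y' ∈ Y')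
    (t : TangentSpace 𝓘(ℂ, C3) y) : mfderiv 𝓘(ℂ, C3) 𝓘(ℂ, V) L y t ∈ coneTangent (L y) := by
  have hcone : ∀ᶠ y' in 𝓝 y, L y' ∈ cone := h.mono fun y' ⟨_, hne, hL⟩ => by
    rw [← mk_mem_Y' hne, hL]; exact hπ y'
  have key : ∀ A : MvPolynomial (Fin 6) ℂ, (∀ v ∈ cone, eval v A = 0) →
      diff A (L y) (mfderiv 𝓘(ℂ, C3) 𝓘(ℂ, V) L y t) = 0 := by
    intro A hA
    have h1 : HasMFDerivAt 𝓘(ℂ, C3) 𝓘(ℂ, ℂ) ((fun v : V => eval v A) ∘ L) y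
        ((LinearMap.toContinuousLinearMap (diff A (L y))).comp
          (mfderiv 𝓘(ℂ, C3) 𝓘(ℂ, V) L y)) :=
      (hasFDerivAt_eval A (L y)).hasMFDerivAt.comp y h.mdifferentiableAt.hasMFDerivAt
    have h2 : HasMFDerivAt 𝓘(ℂ, C3) 𝓘(ℂ, ℂ) ((fun v : V => eval v A) ∘ L) y 0 :=
      (hasMFDerivAt_const (0 : ℂ) y).congr_of_eventuallyEq (hcone.mono fun y' hy' => hA _ hy')
    exact congrArg (fun B : C3 →L[ℂ] ℂ => B t) (hasMFDerivAt_unique h1 h2)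
  exact ⟨key A1 fun v hv => hv.1, key A2 fun v hv => hv.2⟩

/-- A power of `σ` as a continuous linear automorphism. -/
noncomputable def σPow (k : ℕ) : V ≃L[ℂ] V := (σ ^ k).toContinuousLinearEquiv

/-- Undoing `σ ^ k` on a lift at `τ y` yields a lift at `y` for which `L ∘ τ` equals `σ ^ k` of the
new lift exactly, with no scalar function to differentiate. -/
lemma IsLocalLift.comp_lift {τ : Y → Y} (hτ : MDifferentiable 𝓘(ℂ, C3) 𝓘(ℂ, C3) τ) {k : ℕ}
    (hlift : ∀ y, π (τ y) = σ ^ k • π y) (h : IsLocalLift π L (τ y)) :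
    IsLocalLift π ((σPow k).symm ∘ L ∘ τ) y := by
  filter_upwards [(hτ y).continuousAt.eventually h] with y' hy'
  obtain ⟨hd, hne, hL⟩ := hy'
  refine ⟨(σPow k).symm.differentiableAt.mdifferentiableAt.comp y' (hd.comp y' (hτ y')), ?_, ?_⟩
  · simpa using hne
  · have hne' : (σPow k).symm (L (τ y')) ≠ 0 := by simpa using hne
    apply MulAction.injective (σ ^ k)
    change σ ^ k • Projectivization.mk ℂ ((σPow k).symm (L (τ y'))) hne' = σ ^ k • π y'
    rw [← hlift, ← hL, Projectivization.smul_mk]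
    congr 1
    exact (σPow k).apply_symm_apply _

/-- On the preimage of the smooth locus, a lift of `σ ^ k` acts on the extension of `π^* ω_{Y'}` by
`(-1) ^ k`. -/
lemma ExtendsResidue.pullback_eq {Ω : RoughForm Y} (hΩ : ExtendsResidue π Ω) (hπ : IsResolution π)
    {τ : Y → Y} (hτ : MDifferentiable 𝓘(ℂ, C3) 𝓘(ℂ, C3) τ) {k : ℕ}
    (hlift : ∀ y, π (τ y) = σ ^ k • π y) (hy : π y ∈ Y'reg) :
    pullback τ Ω y = (-1 : ℂ) ^ k • Ω y := by
  obtain ⟨L, hL⟩ := hπ.holomorphic (τ y)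
  have hτy : π (τ y) ∈ Y'reg := by rwa [hlift, σ_pow_smul_mem_Y'reg]
  have hL' : IsLocalLift π ((σPow k).symm ∘ L ∘ τ) y := hL.comp_lift hτ hlift
  have hmem : ∀ y', π y' ∈ Y' := fun y' => hπ.range_eq ▸ Set.mem_range_self y'
  have hcomp : L ∘ τ = σPow k ∘ ((σPow k).symm ∘ L ∘ τ) := by
    funext y'; simp
  have hmf : ∀ t : TangentSpace 𝓘(ℂ, C3) y,
      mfderiv 𝓘(ℂ, C3) 𝓘(ℂ, V) L (τ y) (mfderiv 𝓘(ℂ, C3) 𝓘(ℂ, C3) τ y t) =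
        (σ ^ k) (mfderiv 𝓘(ℂ, C3) 𝓘(ℂ, V) ((σPow k).symm ∘ L ∘ τ) y t) := by
    intro t
    have h1 := hL.mdifferentiableAt.hasMFDerivAt.comp y (hτ y).hasMFDerivAt
    have h2 := (σPow k).hasFDerivAt.hasMFDerivAt.comp y hL'.mdifferentiableAt.hasMFDerivAt
    rw [← hcomp] at h2
    exact congrArg (fun B : C3 →L[ℂ] V => B t) (hasMFDerivAt_unique h1 h2)
  refine ContinuousAlternatingMap.ext fun t => ?_
  -- `ExtendsResidue` allows any local lift: `L` is used at `τ y` and its transport at `y`.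
  calc pullback τ Ω y t
      = residueForm (L (τ y)) (fun i => mfderiv 𝓘(ℂ, C3) 𝓘(ℂ, V) L (τ y)
          (mfderiv 𝓘(ℂ, C3) 𝓘(ℂ, C3) τ y (t i))) := hΩ (τ y) hτy L hL _
    _ = residueForm ((σ ^ k) (((σPow k).symm ∘ L ∘ τ) y)) (fun i =>
          (σ ^ k) (mfderiv 𝓘(ℂ, C3) 𝓘(ℂ, V) ((σPow k).symm ∘ L ∘ τ) y (t i))) := by
        congr 1
        · exact congrFun hcomp y
        · exact funext fun i => hmf (t i)
    _ = (-1) ^ k * residueForm (((σPow k).symm ∘ L ∘ τ) y) (fun i =>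
          mfderiv 𝓘(ℂ, C3) 𝓘(ℂ, V) ((σPow k).symm ∘ L ∘ τ) y (t i)) :=
        residueForm_σ_pow k (hL'.mem_smoothCone hy) fun i =>
          hL'.mfderiv_mem_coneTangent hmem (t i)
    _ = ((-1 : ℂ) ^ k • Ω y) t := by
        rw [ContinuousAlternatingMap.smul_apply, hΩ y hy _ hL', smul_eq_mul]

end Lift

lemma pullback_smul {Y : Type*} [TopologicalSpace Y] [ChartedSpace C3 Y] (f : Y → Y) (c : ℂ)
    (ω : RoughForm Y) : pullback f (c • ω) = c • pullback f ω := rfl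

end DelPezzoCY

theorem lemma4p5 :
    -- `σ` restricts to an automorphism of `Y'` of order six, preserving the smooth locus
    (∀ p, DelPezzoCY.σ • p ∈ DelPezzoCY.Y' ↔ p ∈ DelPezzoCY.Y') ∧
    (∀ p, DelPezzoCY.σ • p ∈ DelPezzoCY.Y'reg ↔ p ∈ DelPezzoCY.Y'reg) ∧
    (∀ k : ℕ, (∀ p ∈ DelPezzoCY.Y', DelPezzoCY.σ ^ k • p = p) ↔ 6 ∣ k) ∧
    -- `(σ ^ k)^* ω_{Y'} = (-1) ^ k ω_{Y'}` on the smooth locus of `Y'`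
    (∀ k : ℕ, ∀ v ∈ DelPezzoCY.smoothCone, ∀ x : Fin 3 → DelPezzoCY.V,
      (∀ i, x i ∈ DelPezzoCY.coneTangent v) →
      DelPezzoCY.residueForm ((DelPezzoCY.σ ^ k) v) (fun i => (DelPezzoCY.σ ^ k) (x i)) =
        (-1) ^ k * DelPezzoCY.residueForm v x) ∧
    -- the action on `H^{3,0}` of every crepant resolution of `Y'`
    (∀ (Y : Type*) [TopologicalSpace Y] [T2Space Y] [CompactSpace Y] [ConnectedSpace Y]
      [ChartedSpace DelPezzoCY.C3 Y] [IsManifold 𝓘(ℂ, DelPezzoCY.C3) 1 Y]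
      (π : Y → DelPezzoCY.P5), DelPezzoCY.IsResolution π → DelPezzoCY.IsCrepant π →
      ∀ (k : ℕ) (τ : Y → Y), MDifferentiable 𝓘(ℂ, DelPezzoCY.C3) 𝓘(ℂ, DelPezzoCY.C3) τ →
      (∀ y, π (τ y) = DelPezzoCY.σ ^ k • π y) →
      ∀ ω ∈ DelPezzoCY.H30 Y, DelPezzoCY.pullback τ ω = (-1 : ℂ) ^ k • ω) := by
  refine ⟨DelPezzoCY.σ_smul_mem_Y', DelPezzoCY.σ_smul_mem_Y'reg,
    DelPezzoCY.σ_pow_smul_eq_self_iff, fun k v hv x hx => DelPezzoCY.residueForm_σ_pow k hv hx, ?_⟩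
  intro Y _ _ _ _ _ _ π hπ ⟨Ω, hΩ, hne, hext⟩ k τ hτ hlift ω hω
  -- `H30 Y` is spanned by `Ω`, so the claim for `Ω` suffices.
  obtain ⟨c, rfl⟩ := DelPezzoCY.exists_eq_smul_of_mem_H30 hω hΩ hne
  have hpull : DelPezzoCY.pullback τ Ω = (-1 : ℂ) ^ k • Ω :=
    DelPezzoCY.pullback_eq_smul_of_dense hΩ hτ hπ.dense fun y hy =>
      hext.pullback_eq hπ hτ hlift hy
  rw [DelPezzoCY.pullback_smul, hpull, smul_comm]
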